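/- Let $a<b$ be real numbers and let $m\ge 1$ be an integer. For $n\ge 1$ let $t_i=a+i\,\frac{b-a}{n}$, $0\le i\le n$, be the $n+1$ equidistant nodes, and write $\|\cdot\|_\infty$ for the supremum norm on $[a,b]$. A clamped knot sequence (for $n+1$ B-splines of degree $m$) is a nondecreasing sequence $\tau_0\le\tau_1\le\dots\le\tau_{n+m+1}$ with $\tau_0=\dots=\tau_m=a$ and $\tau_{n+1}=\dots=\tau_{n+m+1}=b$. The B-splines $\mathcal B_{j,k}$ on it are given by the Cox–de Boor recursion: $\mathcal B_{j,0}$ is the indicator function of $[\tau_j,\tau_{j+1})$ (the last nonempty knot interval, ending at $b$, being taken closed), and for $k\ge1$ $$\mathcal B_{j,k}(t)=\frac{t-\tau_j}{\tau_{j+k}-\tau_j}\,\mathcal B_{j,k-1}(t)+\frac{\tau_{j+k+1}-t}{\tau_{j+k+1}-\tau_{j+1}}\,\mathcal B_{j+1,k-1}(t),$$ where a quotient with zero denominator counts as $0$. Let $S$ be the set of continuous functions on $[a,b]$ of the form $\sum_{j=0}^n c_j\mathcal B_{j,m}$ with $c_j\in\mathbb R$. The interpolation operator is well defined if for every $g\in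 C[a,b]$ there is exactly one $Ig\in S$ with $(Ig)(t_i)=g(t_i)$ for $0\le i\le n$. It is bounded if $$\|I\|:=\sup\Big\{\frac{\|Ig\|_\infty}{\|g\|_\infty}: g\in C[a,b],\ g\ne0\Big\}<\infty .$$ **Theorem 4.1.** 1. There is a constant $C_{m,a,b}>0$ depending only on $m,a,b$ such that for every $n\ge1$, every clamped knot sequence for which the interpolation operator $I$ is well defined and bounded, and every $f\in C^m[a,b]$, the B-spline interpolant $\mu=If$ of degree $m$ satisfies $$\|f-\mu\|_\infty\le(1+\|I\|)\,C_{m,a,b}\,n^{-m}\,\|f^{(m)}\|_\infty .$$ 2. For every $n\ge1$ and every $f\in C^2[a,b]$, the piecewise linear interpolant $p_1(t)=f(t_i)+\frac{f(t_{i+1})-f(t_i)}{t_{i+1}-t_i}(t-t_i)$ for $t\in[t_i,t_{i+1}]$, $0\le i<n$, satisfies $$\|f-p_1\|_\infty\le\frac{(b-a)^2}{8}\,\|f''\|_\infty\,n^{-2}.$$ -/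

import Mathlib

open Set

/-- The B-spline of degree `m` and index `j` on the knot sequence `τ`, by the Cox-de Boor recursion
(a quotient with zero denominator counts as `0`). In degree `0` it is the indicator function of
`[τ j, τ (j+1))`; as usual, the last nonempty knot interval, the one that ends at the right endpoint
`b`, is taken to be closed. -/
noncomputable def coxDeBoor (τ : ℕ → ℝ) (b : ℝ) : ℕ → ℕ → ℝ → ℝ
  | 0, j, t =>
    open Classical in
    if (τ j ≤ t ∧ t < τ (j + 1)) ∨ (τ j < τ (j + 1) ∧ τ (j + 1) = b ∧ t = b) then 1 else 0
  | m + 1, j, t =>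
    (t - τ j) / (τ (j + m + 1) - τ j) * coxDeBoor τ b m j t
      + (τ (j + m + 2) - t) / (τ (j + m + 2) - τ (j + 1)) * coxDeBoor τ b m (j + 1) t

/-- `τ 0 ≤ ... ≤ τ (n+m+1)` is a clamped knot sequence on `[a, b]` for `n + 1` B-splines of
degree `m`: the first and the last `m + 1` knots are `a` and `b` respectively. Only the knots with
index at most `n + m + 1` matter. -/
structure IsClampedKnots (a b : ℝ) (m n : ℕ) (τ : ℕ → ℝ) : Prop where
  mono : MonotoneOn τ (Set.Icc 0 (n + m + 1))
  left : ∀ i, i ≤ m → τ i = a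
  right : ∀ i, n + 1 ≤ i → i ≤ n + m + 1 → τ i = b

/-- The continuous functions on `[a, b]` of the form `∑ c_j B_{j,m}`, `0 ≤ j ≤ n`. -/
def splineSpace (a b : ℝ) (m n : ℕ) (τ : ℕ → ℝ) : Set C(Icc a b, ℝ) :=
  {s | ∃ c : Fin (n + 1) → ℝ, ∀ x : Icc a b,
    s x = ∑ j : Fin (n + 1), c j * coxDeBoor τ b m (j : ℕ) (x : ℝ)}

theorem equiNode_mem {a b : ℝ} (hab : a ≤ b) (n : ℕ) (i : Fin (n + 1)) :
    a + (i : ℕ) * ((b - a) / n) ∈ Icc a b := by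
  have hi : ((i : ℕ) : ℝ) ≤ n := by exact_mod_cast Nat.lt_succ_iff.mp i.2
  have hba : 0 ≤ b - a := sub_nonneg.mpr hab
  have h0 : 0 ≤ (b - a) / (n : ℝ) := by positivity
  refine ⟨by have : 0 ≤ ((i : ℕ) : ℝ) * ((b - a) / n) := by positivity
             linarith, ?_⟩
  have h1 : ((i : ℕ) : ℝ) * ((b - a) / n) ≤ n * ((b - a) / n) := by gcongr
  have h2 : (n : ℝ) * ((b - a) / n) ≤ b - a := by
    rcases Nat.eq_zero_or_pos n with rfl | hn
    · simpa using hba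
    · have : (n : ℝ) ≠ 0 := by positivity
      exact le_of_eq (by field_simp)
  linarith

/-- The equidistant nodes `t_i = a + i (b - a) / n`, `0 ≤ i ≤ n`. -/
noncomputable def equiNode {a b : ℝ} (hab : a ≤ b) (n : ℕ) (i : Fin (n + 1)) : Icc a b :=
  ⟨a + (i : ℕ) * ((b - a) / n), equiNode_mem hab n i⟩

/-- The interpolation operator is well defined: every continuous function is interpolated at the
equidistant nodes by exactly one spline. -/
def InterpolationWellDefined {a b : ℝ} (hab : a ≤ b) (m n : ℕ) (τ : ℕ → ℝ) : Prop :=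
  ∀ g : C(Icc a b, ℝ), ∃! s : C(Icc a b, ℝ),
    s ∈ splineSpace a b m n τ ∧ ∀ i : Fin (n + 1), s (equiNode hab n i) = g (equiNode hab n i)

/-- The interpolation operator `I`: it sends `g` to the spline that interpolates `g`. -/
noncomputable def splineInterpolation {a b : ℝ} {hab : a ≤ b} {m n : ℕ} {τ : ℕ → ℝ}
    (hI : InterpolationWellDefined hab m n τ) (g : C(Icc a b, ℝ)) : C(Icc a b, ℝ) :=
  (hI g).exists.choose

/-- The set of quotients `‖I g‖ / ‖g‖`, with `g ≠ 0` continuous on `[a, b]` (sup norms). -/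
def interpolationRatios {a b : ℝ} {hab : a ≤ b} {m n : ℕ} {τ : ℕ → ℝ}
    (hI : InterpolationWellDefined hab m n τ) : Set ℝ :=
  {r | ∃ g : C(Icc a b, ℝ), g ≠ 0 ∧ r = ‖splineInterpolation hI g‖ / ‖g‖}

/-- The operator norm `‖I‖`, meaningful when `interpolationRatios hI` is bounded above. -/
noncomputable def interpolationNorm {a b : ℝ} {hab : a ≤ b} {m n : ℕ} {τ : ℕ → ℝ}
    (hI : InterpolationWellDefined hab m n τ) : ℝ :=
  sSup (interpolationRatios hI)

/-- A function that is continuous on `[a, b]`, as an element of `C([a, b])`. -/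
def toContIcc {a b : ℝ} (f : ℝ → ℝ) (hf : ContinuousOn f (Icc a b)) : C(Icc a b, ℝ) :=
  ⟨fun x => f x, continuousOn_iff_continuous_domRestrict.mp hf⟩

/-- The supremum norm on `[a, b]` (used only for functions that are continuous there). -/
noncomputable def supNormIcc (a b : ℝ) (u : ℝ → ℝ) : ℝ :=
  ⨆ x : Icc a b, |u x|

/-- The piecewise linear interpolant of `f` at the nodes `t_i = a + i (b - a) / n`. The point `t`
lies in `[t_i, t_{i+1}]`, where `i = min ⌊(t - a) / ((b - a) / n)⌋ (n - 1)`. -/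
noncomputable def piecewiseLinear (a b : ℝ) (n : ℕ) (f : ℝ → ℝ) (t : ℝ) : ℝ :=
  let h : ℝ := (b - a) / n
  let i : ℕ := min ⌊(t - a) / h⌋₊ (n - 1)
  let u : ℝ := a + (i : ℝ) * h
  let v : ℝ := a + ((i : ℝ) + 1) * h
  f u + (f v - f u) / (v - u) * (t - u)

/-! Part 1 combines Lebesgue's inequality with a local quasi-interpolant. Since `I` fixes splines,
the interpolation error is at most `1 + ‖I‖` times the distance from `f` to any one spline
(`norm_sub_splineInterpolation_le`). The spline chosen has coefficients built from values of `f` at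
means of interior knots of each B-spline. By polarization and Marsden's identity it reproduces
polynomials of degree at most `m`, so Taylor expansion bounds its error by a constant times `D ^ m *
‖f^(m)‖`, where `D` bounds the support lengths (`quasiInterpolant_error`).

The knots are arbitrary, so `D = O(1/n)` must come from well-posedness: unique solvability makes the
collocation map injective, and the necessary Schoenberg-Whitney conditions then tie the knots to the
equidistant nodes (`support_length_le`).

Part 2 is a convexity argument on each node interval. -/

/-! ### Polarization and Taylor's formula. -/

/-- The polarization identity. -/
theorem polarization_prod {R : Type*} [CommRing R] (m : ℕ) (x : Fin m → R) :
    ∑ S : Finset (Fin m), (-1) ^ (Finset.univ \ S).card * (∑ i ∈ S, x i) ^ m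
      = (m.factorial : R) * ∏ i, x i := by
  classical
  -- The product over the complement of `S` is the indicator of `range g ⊆ S`.
  have expand : ∀ S : Finset (Fin m), (∑ i ∈ S, x i) ^ m =
      ∑ g : Fin m → Fin m, (∏ i ∈ Finset.univ \ S, if i ∈ range g then 0 else 1) *
        ∏ k, x (g k) := by
    intro S
    rw [Finset.sum_subset (Finset.subset_univ S) (f := fun i => if i ∈ S then x i else 0)
      (by intro i _ hi; simp [hi]) |>.symm.trans
        (Finset.sum_congr rfl fun i hi => by simp [hi]) |>.symm]
    have := Finset.prod_univ_sum (fun _ : Fin m => (Finset.univ : Finset (Fin m)))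
      (fun _ i => if i ∈ S then x i else 0)
    rw [Finset.prod_const, Finset.card_univ, Fintype.card_fin] at this
    rw [this, Fintype.piFinset_univ]
    refine Finset.sum_congr rfl fun g _ => ?_
    by_cases h : ∀ k, g k ∈ S
    · rw [Finset.prod_congr rfl fun k _ => if_pos (h k), Finset.prod_eq_one (s := Finset.univ \ S), one_mul]
      intro i hi
      rw [if_neg]
      rintro ⟨k, rfl⟩
      simp [h k] at hi
    · obtain ⟨k, hk⟩ := not_forall.mp h
      rw [Finset.prod_eq_zero (Finset.mem_univ k) (if_neg hk),
        Finset.prod_eq_zero (i := g k) (by simp [hk]) (by simp), zero_mul]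
  -- Inclusion-exclusion: the sum factors over `i`, and the factor is `1` if `i` is in the range of
  -- `g` and `0` otherwise. Only permutations survive.
  have signs : ∀ g : Fin m → Fin m,
      ∑ S : Finset (Fin m), (-1) ^ (Finset.univ \ S).card *
        (∏ i ∈ Finset.univ \ S, if i ∈ range g then (0 : R) else 1)
        = if Function.Bijective g then 1 else 0 := by
    intro g
    have h := Finset.prod_add (fun _ : Fin m => (1 : R))
      (fun i => -1 * if i ∈ range g then (0 : R) else 1) Finset.univ
    simp only [Finset.prod_mul_distrib, Finset.prod_const, one_mul,
      Finset.powerset_univ, one_pow] at h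
    rw [← h]
    split_ifs with hg
    · exact Finset.prod_eq_one fun i _ => by
        have hi : i ∈ range g := hg.surjective i
        simp only [if_pos hi, mul_zero, add_zero]
    · have : ¬ Function.Surjective g := fun h' => hg ⟨Finite.injective_iff_surjective.mpr h', h'⟩
      obtain ⟨i, hi⟩ := not_forall.mp this
      exact Finset.prod_eq_zero (Finset.mem_univ i) (by rw [if_neg (by simpa using hi)]; simp)
  simp_rw [expand, Finset.mul_sum, ← mul_assoc]
  rw [Finset.sum_comm]
  simp_rw [← Finset.sum_mul, signs, ite_mul, one_mul, zero_mul]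
  rw [← Finset.sum_filter]
  have : ∀ g ∈ Finset.univ.filter (fun g : Fin m → Fin m => Function.Bijective g),
      ∏ k, x (g k) = ∏ i, x i := fun g hg =>
    (Finset.mem_filter.mp hg).2.prod_comp x
  rw [Finset.sum_congr rfl this, Finset.sum_const, nsmul_eq_mul]
  congr 2
  have := Fintype.card_perm (α := Fin m)
  rw [Fintype.card_fin] at this
  rw [← this, ← Fintype.card_subtype]
  exact Fintype.card_congr ⟨fun g => Equiv.ofBijective g.1 g.2, fun σ => ⟨σ, σ.bijective⟩,
    fun _ => rfl, fun _ => Equiv.ext fun _ => rfl⟩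

/-- The derivative of the remainder is the remainder of the derivative, so induction and the mean
value inequality suffice. The factor `1 / m!` is given up. -/
theorem taylor_remainder_le {a b M t y : ℝ} (ht : t ∈ Icc a b) (hy : y ∈ Icc a b) (m : ℕ) :
    ∀ (F : ℕ → ℝ → ℝ),
      (∀ k < m, ∀ x ∈ Icc a b, HasDerivWithinAt (F k) (F (k + 1) x) (Icc a b) x) →
      (∀ x ∈ Icc a b, |F m x| ≤ M) →
      |F 0 y - ∑ k ∈ Finset.range m, F k t / k.factorial * (y - t) ^ k| ≤ M * |y - t| ^ m := by
  induction m generalizing y with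
  | zero => intro F _ hM; simpa using hM y hy
  | succ m ih =>
    intro F hF hM
    have hsub : uIcc t y ⊆ Icc a b := ordConnected_Icc.uIcc_subset ht hy
    let G : ℝ → ℝ := fun x => F 0 x - ∑ k ∈ Finset.range (m + 1), F k t / k.factorial * (x - t) ^ k
    have hG0 : G t = 0 := by simp [G, Finset.sum_range_succ']
    have hG : ∀ x ∈ uIcc t y, HasDerivWithinAt G
        (F 1 x - ∑ k ∈ Finset.range m, F (k + 1) t / k.factorial * (x - t) ^ k) (uIcc t y) x := by
      intro x hx
      refine ((hF 0 m.succ_pos x (hsub hx)).mono hsub).sub ?_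
      simp only [Finset.sum_range_succ' _ m, pow_zero, mul_one]
      refine HasDerivWithinAt.add_const _ ?_
      refine HasDerivWithinAt.fun_sum fun k _ => ?_
      have h := ((((hasDerivAt_id x).sub_const t).pow (k + 1)).const_mul
        (F (k + 1) t / (k + 1).factorial)).hasDerivWithinAt (s := uIcc t y)
      refine HasDerivWithinAt.congr_deriv h ?_
      rw [Nat.factorial_succ, Nat.add_sub_cancel, id]
      push_cast
      have : (k.factorial : ℝ) ≠ 0 := by positivity
      have : (k : ℝ) + 1 ≠ 0 := by positivity
      field_simp
    have hM0 : 0 ≤ M := (abs_nonneg _).trans (hM t ht)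
    have key := Convex.norm_image_sub_le_of_norm_hasDerivWithin_le (C := M * |y - t| ^ m) hG
      (fun x hx => by
        have h1 := ih (hsub hx) (fun k => F (k + 1)) (fun k hk => hF (k + 1) (by omega)) hM
        refine h1.trans ?_
        have : |x - t| ≤ |y - t| := abs_sub_left_of_mem_uIcc hx
        gcongr)
      (convex_uIcc t y) left_mem_uIcc right_mem_uIcc
    rw [hG0, sub_zero, Real.norm_eq_abs, Real.norm_eq_abs] at key
    calc _ ≤ _ := key
      _ = _ := by ring

/-! ### B-splines and Marsden's identity. -/

section BSpline

variable {τ : ℕ → ℝ} {a b t : ℝ}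

theorem coxDeBoor_succ (τ : ℕ → ℝ) (b : ℝ) (k j : ℕ) (t : ℝ) :
    coxDeBoor τ b (k + 1) j t =
      (t - τ j) / (τ (j + k + 1) - τ j) * coxDeBoor τ b k j t
        + (τ (j + k + 2) - t) / (τ (j + k + 2) - τ (j + 1)) * coxDeBoor τ b k (j + 1) t := rfl

/-- `τ` is nondecreasing up to the index `N`. -/
abbrev MonoUpTo (τ : ℕ → ℝ) (N : ℕ) : Prop := MonotoneOn τ (Icc 0 N)

theorem MonoUpTo.le {N i j : ℕ} (h : MonoUpTo τ N) (hij : i ≤ j) (hj : j ≤ N) : τ i ≤ τ j :=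
  h ⟨i.zero_le, hij.trans hj⟩ ⟨j.zero_le, hj⟩ hij

/-- The strict inequality ensures that a recursion denominator is nonzero whenever the B-spline it
multiplies is. -/
theorem coxDeBoor_support {N : ℕ} (hτ : MonoUpTo τ N) (k j : ℕ) (hj : j + k + 1 ≤ N)
    (h : coxDeBoor τ b k j t ≠ 0) :
    τ j ≤ t ∧ t ≤ τ (j + k + 1) ∧ τ j < τ (j + k + 1) := by
  induction k generalizing j with
  | zero =>
    simp only [coxDeBoor, ne_eq, ite_eq_right_iff, one_ne_zero, imp_false, not_not] at h
    rcases h with ⟨h1, h2⟩ | ⟨h1, h2, h3⟩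
    · exact ⟨h1, h2.le, h1.trans_lt h2⟩
    · subst h3
      exact ⟨h2 ▸ h1.le, h2.ge, h1⟩
  | succ k ih =>
    rw [coxDeBoor_succ] at h
    have e : j + 1 + k + 1 = j + (k + 1) + 1 := by ring
    by_cases h0 : coxDeBoor τ b k j t = 0
    · have h1 : coxDeBoor τ b k (j + 1) t ≠ 0 := fun h1 => h (by simp [h0, h1])
      obtain ⟨p, q, r⟩ := ih (j + 1) (by omega) h1
      rw [e] at q r
      have := hτ.le j.le_succ (by omega)
      exact ⟨this.trans p, q, this.trans_lt r⟩
    · obtain ⟨p, q, r⟩ := ih j (by omega) h0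
      have := hτ.le (i := j + k + 1) (j := j + (k + 1) + 1) (by omega) hj
      exact ⟨p, q.trans this, r.trans_le this⟩

theorem coxDeBoor_nonneg {N : ℕ} (hτ : MonoUpTo τ N) (k j : ℕ) (hj : j + k + 1 ≤ N) :
    0 ≤ coxDeBoor τ b k j t := by
  induction k generalizing j with
  | zero =>
    rw [coxDeBoor]
    split_ifs <;> norm_num
  | succ k ih =>
    rw [coxDeBoor_succ]
    refine add_nonneg ?_ ?_
    · by_cases h : coxDeBoor τ b k j t = 0
      · simp [h]
      · obtain ⟨p, -, r⟩ := coxDeBoor_support hτ k j (by omega) h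
        exact mul_nonneg (div_nonneg (sub_nonneg.mpr p) (sub_nonneg.mpr r.le)) (ih j (by omega))
    · by_cases h : coxDeBoor τ b k (j + 1) t = 0
      · simp [h]
      · obtain ⟨-, q, r⟩ := coxDeBoor_support hτ k (j + 1) (by omega) h
        rw [show j + 1 + k + 1 = j + k + 2 by ring] at q r
        exact mul_nonneg (div_nonneg (sub_nonneg.mpr q) (sub_nonneg.mpr r.le))
          (ih (j + 1) (by omega))

theorem IsClampedKnots.monoUpTo {m n : ℕ} (h : IsClampedKnots a b m n τ) :
    MonoUpTo τ (n + m + 1) := h.mono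

theorem IsClampedKnots.degree_le {m n : ℕ} (h : IsClampedKnots a b m n τ) (hab : a < b) :
    m ≤ n := by
  by_contra! hlt
  exact hab.ne ((h.left (n + 1) hlt).symm.trans (h.right (n + 1) le_rfl (by omega)))

theorem sum_coxDeBoor_zero {m n : ℕ} (h : IsClampedKnots a b m n τ) (hab : a < b)
    (ht : t ∈ Icc a b) : ∑ j ∈ Finset.range (n + 1), coxDeBoor τ b 0 j t = 1 := by
  classical
  -- The indicators telescope through `g`; the condition `τ j < b` accounts for the closed last
  -- interval when `t = b`.
  let g : ℕ → ℝ := fun j => if τ j ≤ t ∧ τ j < b then 1 else 0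
  have hg : ∀ j ∈ Finset.range (n + 1), coxDeBoor τ b 0 j t = g j - g (j + 1) := by
    intro j hj
    have hj := Finset.mem_range.mp hj
    have h1 : τ j ≤ τ (j + 1) := h.monoUpTo.le j.le_succ (by omega)
    have h2 : τ (j + 1) ≤ b := by
      rw [← h.right (n + 1) le_rfl (by omega)]
      exact h.monoUpTo.le (by omega) (by omega)
    have h3 := ht.2
    simp only [coxDeBoor, g]
    split_ifs <;> first | (norm_num; done) | (exfalso; grind)
  rw [Finset.sum_congr rfl hg, Finset.sum_range_sub']
  have h0 : τ 0 = a := h.left 0 m.zero_le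
  have h1 : τ (n + 1) = b := h.right (n + 1) le_rfl (by omega)
  simp [g, h0, h1, hab, ht.1]

theorem coxDeBoor_eq_zero_of_knots_eq {N k j : ℕ} (hτ : MonoUpTo τ N) (hj : j + k + 1 ≤ N)
    (h : τ j = τ (j + k + 1)) : coxDeBoor τ b k j t = 0 := by
  by_contra h0
  exact (coxDeBoor_support hτ k j hj h0).2.2.ne h

/-- Marsden's identity. -/
theorem marsden_identity {A : Type*} [CommRing A] [Algebra ℝ A] {m n : ℕ}
    (h : IsClampedKnots a b m n τ) (hab : a < b) (ht : t ∈ Icc a b) (u v : A) (k : ℕ)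
    (hk : k ≤ m) :
    ∑ j ∈ Finset.range (n + 1), algebraMap ℝ A (coxDeBoor τ b k j t) *
        ∏ i ∈ Finset.range k, (u + v * algebraMap ℝ A (τ (j + 1 + i)))
      = (u + v * algebraMap ℝ A t) ^ k := by
  have hmn := h.degree_le hab
  induction k with
  | zero =>
    simp only [Finset.range_zero, Finset.prod_empty, mul_one, pow_zero]
    rw [← map_sum, sum_coxDeBoor_zero h hab ht, map_one]
  | succ k ih =>
    let ω : ℕ → ℝ := fun j => (t - τ j) / (τ (j + k + 1) - τ j)
    let ω' : ℕ → ℝ := fun j => (τ (j + k + 1) - t) / (τ (j + k + 1) - τ j)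
    let P : ℕ → A := fun j => ∏ i ∈ Finset.range k, (u + v * algebraMap ℝ A (τ (j + 1 + i)))
    -- `X j` and `Y (j + 1)` are the two halves of the recursion, each with a different knot factor
    -- split off. Shifting `Y` gathers both contributions of the same lower-degree B-spline; the end
    -- terms vanish because the knots are clamped.
    let X : ℕ → A := fun j => algebraMap ℝ A (ω j * coxDeBoor τ b k j t) *
      (P j * (u + v * algebraMap ℝ A (τ (j + k + 1))))
    let Y : ℕ → A := fun j => algebraMap ℝ A (ω' j * coxDeBoor τ b k j t) *
      (P j * (u + v * algebraMap ℝ A (τ j)))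
    have hXY : ∀ j, algebraMap ℝ A (coxDeBoor τ b (k + 1) j t) *
        ∏ i ∈ Finset.range (k + 1), (u + v * algebraMap ℝ A (τ (j + 1 + i)))
          = X j + Y (j + 1) := by
      intro j
      have e1 : ∏ i ∈ Finset.range (k + 1), (u + v * algebraMap ℝ A (τ (j + 1 + i)))
          = P j * (u + v * algebraMap ℝ A (τ (j + k + 1))) := by
        rw [Finset.prod_range_succ, show j + 1 + k = j + k + 1 by ring]
      have e2 : ∏ i ∈ Finset.range (k + 1), (u + v * algebraMap ℝ A (τ (j + 1 + i)))
          = P (j + 1) * (u + v * algebraMap ℝ A (τ (j + 1))) := by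
        rw [Finset.prod_range_succ', add_zero]
        congr 1
        exact Finset.prod_congr rfl fun i _ => by rw [show j + 1 + (i + 1) = j + 1 + 1 + i by ring]
      rw [coxDeBoor_succ, map_add, add_mul]
      nth_rw 1 [e1]
      rw [e2]
      simp only [X, Y, ω, ω', show j + 1 + k + 1 = j + k + 2 by ring]
    have hY0 : Y 0 = 0 := by
      have : coxDeBoor τ b k 0 t = 0 := coxDeBoor_eq_zero_of_knots_eq h.monoUpTo (by omega) (by
        rw [h.left 0 (by omega), h.left _ (by omega)])
      simp [Y, this]
    have hYn : Y (n + 1) = 0 := by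
      have : coxDeBoor τ b k (n + 1) t = 0 :=
        coxDeBoor_eq_zero_of_knots_eq h.monoUpTo (by omega) (by
          rw [h.right (n + 1) (by omega) (by omega), h.right _ (by omega) (by omega)])
      simp [Y, this]
    have hshift : ∑ j ∈ Finset.range (n + 1), Y (j + 1) = ∑ j ∈ Finset.range (n + 1), Y j := by
      have h1 := Finset.sum_range_succ' Y (n + 1)
      rw [Finset.sum_range_succ, hY0, hYn, add_zero, add_zero] at h1
      exact h1.symm
    rw [Finset.sum_congr rfl fun j _ => hXY j, Finset.sum_add_distrib, hshift,
      ← Finset.sum_add_distrib, pow_succ, ← ih (by omega), Finset.sum_mul]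
    refine Finset.sum_congr rfl fun j hj => ?_
    have hj := Finset.mem_range.mp hj
    by_cases h0 : coxDeBoor τ b k j t = 0
    · simp [X, Y, h0]
    · have hlt := (coxDeBoor_support h.monoUpTo k j (by omega) h0).2.2
      have hne : τ (j + k + 1) - τ j ≠ 0 := sub_ne_zero.mpr hlt.ne'
      -- The weights express `t` as an affine combination of the two end knots, so the split-off
      -- factors combine to `u + v t`.
      have w1 : ω j + ω' j = 1 := by
        simp only [ω, ω']
        field_simp
        ring
      have w2 : ω j * τ (j + k + 1) + ω' j * τ j = t := by
        simp only [ω, ω']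
        field_simp
        ring
      have w1' := congrArg (algebraMap ℝ A) w1
      have w2' := congrArg (algebraMap ℝ A) w2
      simp only [map_add, map_mul, map_one] at w1' w2'
      simp only [X, Y, map_mul]
      linear_combination (algebraMap ℝ A (coxDeBoor τ b k j t) * P j * u) * w1' +
        (algebraMap ℝ A (coxDeBoor τ b k j t) * P j * v) * w2'

theorem sum_coxDeBoor_eq_one {m n : ℕ} (h : IsClampedKnots a b m n τ) (hab : a < b)
    (ht : t ∈ Icc a b) : ∑ j ∈ Finset.range (n + 1), coxDeBoor τ b m j t = 1 := by
  simpa using marsden_identity h hab ht (1 : ℝ) 0 m le_rfl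

end BSpline

/-! ### The quasi-interpolant and its error. -/

section QuasiInterpolant

/-- The weight of the subset `S` in the polarization identity, when sums are replaced by means. -/
noncomputable def polarWeight (m : ℕ) (S : Finset (Fin m)) : ℝ :=
  (-1) ^ (Finset.univ \ S).card * (S.card : ℝ) ^ m / m.factorial

/-- The mean of the knots `τ (j + 1 + i)`, `i ∈ S`. -/
noncomputable def knotMean (τ : ℕ → ℝ) {m : ℕ} (j : ℕ) (S : Finset (Fin m)) : ℝ :=
  (∑ i ∈ S, τ (j + 1 + i)) / S.card

/-- The coefficients of the quasi-interpolant: polarization of `f` at the interior knots of each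
B-spline. -/
noncomputable def quasiCoeff (τ : ℕ → ℝ) (m : ℕ) (f : ℝ → ℝ) (j : ℕ) : ℝ :=
  ∑ S : Finset (Fin m), polarWeight m S * f (knotMean τ j S)

variable {τ : ℕ → ℝ} {a b t : ℝ} {m n : ℕ}

theorem polarWeight_empty (hm : 1 ≤ m) : polarWeight m ∅ = 0 := by
  simp [polarWeight, show m ≠ 0 by omega]

/-- Polarization of the affine factors: a sum over `S` is `S.card` times the value at the mean, and
`S.card ^ m` is absorbed in the weight. Sampling at means keeps the points within the support. -/
theorem sum_polarWeight_mul_pow {A : Type*} [CommRing A] [Algebra ℝ A] (hm : 1 ≤ m) (j : ℕ)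
    (u v : A) :
    ∑ S : Finset (Fin m), algebraMap ℝ A (polarWeight m S) *
        (u + v * algebraMap ℝ A (knotMean τ j S)) ^ m
      = ∏ i ∈ Finset.range m, (u + v * algebraMap ℝ A (τ (j + 1 + i))) := by
  have hf : (m.factorial : ℝ) ≠ 0 := by positivity
  have h := polarization_prod m fun i : Fin m => u + v * algebraMap ℝ A (τ (j + 1 + i))
  have h' := congrArg (algebraMap ℝ A ((m.factorial : ℝ)⁻¹) * ·) h
  simp only [← mul_assoc, Finset.mul_sum] at h'
  rw [← map_natCast (algebraMap ℝ A), ← map_mul, inv_mul_cancel₀ hf, map_one, one_mul,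
    Fin.prod_univ_eq_prod_range (fun i => u + v * algebraMap ℝ A (τ (j + 1 + i)))] at h'
  rw [← h']
  refine Finset.sum_congr rfl fun S _ => ?_
  rcases S.eq_empty_or_nonempty with rfl | hS
  · simp [polarWeight_empty hm, show m ≠ 0 by omega]
  have hc : (S.card : ℝ) ≠ 0 := by exact_mod_cast hS.card_pos.ne'
  have e : ∑ i ∈ S, (u + v * algebraMap ℝ A (τ (j + 1 + i)))
      = algebraMap ℝ A S.card * (u + v * algebraMap ℝ A (knotMean τ j S)) := by
    have : algebraMap ℝ A S.card * algebraMap ℝ A (knotMean τ j S)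
        = ∑ i ∈ S, algebraMap ℝ A (τ (j + 1 + i)) := by
      rw [← map_mul, ← map_sum, knotMean, mul_div_cancel₀ _ hc]
    rw [Finset.sum_add_distrib, ← Finset.mul_sum, ← this, Finset.sum_const, nsmul_eq_mul,
      map_natCast]
    ring
  rw [e, mul_pow, polarWeight, div_eq_mul_inv]
  simp only [map_mul, map_pow, map_neg, map_one]
  ring

theorem sum_coxDeBoor_mul_quasi_pow (h : IsClampedKnots a b m n τ) (hab : a < b)
    (ht : t ∈ Icc a b) (hm : 1 ≤ m) {k : ℕ} (hk : k ≤ m) :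
    ∑ j ∈ Finset.range (n + 1), coxDeBoor τ b m j t *
        quasiCoeff τ m (fun y => (y - t) ^ k) j = if k = 0 then 1 else 0 := by
  -- Over `ℝ[X]` the right side is `X ^ m`; comparing coefficients of `X ^ (m - k)` isolates the
  -- `k`-th moment about `t`.
  have h1 := marsden_identity h hab ht (Polynomial.X - Polynomial.C t : Polynomial ℝ) 1 m le_rfl
  simp_rw [← sum_polarWeight_mul_pow hm, ← Polynomial.C_eq_algebraMap, one_mul,
    sub_add_cancel, sub_add_eq_add_sub, add_sub_assoc, ← Polynomial.C_sub] at h1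
  have h2 := congrArg (Polynomial.coeff · (m - k)) h1
  simp only [Polynomial.finsetSum_coeff, Polynomial.coeff_C_mul, Polynomial.coeff_X_add_C_pow,
    Polynomial.coeff_X_pow, Nat.sub_sub_self hk, Nat.choose_symm hk, ← mul_assoc,
    ← Finset.sum_mul] at h2
  have hc : (m.choose k : ℝ) ≠ 0 := by exact_mod_cast (Nat.choose_pos hk).ne'
  simp only [quasiCoeff]
  rcases Nat.eq_zero_or_pos k with rfl | hk0
  · simpa using h2
  · rw [if_neg (by omega)] at h2 ⊢
    exact (mul_eq_zero.mp h2).resolve_right hc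

/-- The norm bound of the quasi-interpolant coefficients. -/
noncomputable def polarConst (m : ℕ) : ℝ := ∑ S : Finset (Fin m), |polarWeight m S|

theorem polarConst_nonneg (m : ℕ) : 0 ≤ polarConst m :=
  Finset.sum_nonneg fun _ _ => abs_nonneg _

theorem knotMean_mem {N : ℕ} (hτ : MonoUpTo τ N) {j : ℕ} (hj : j + m + 1 ≤ N)
    {S : Finset (Fin m)} (hS : S.Nonempty) : knotMean τ j S ∈ Icc (τ j) (τ (j + m + 1)) := by
  have hc : (0 : ℝ) < S.card := by exact_mod_cast hS.card_pos
  have key : ∀ i ∈ S, τ j ≤ τ (j + 1 + i) ∧ τ (j + 1 + i) ≤ τ (j + m + 1) := fun i _ =>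
    ⟨hτ.le (by omega) (by omega), hτ.le (by omega) hj⟩
  rw [knotMean]
  constructor
  · rw [le_div_iff₀ hc, mul_comm, ← nsmul_eq_mul]
    exact Finset.card_nsmul_le_sum _ _ _ fun i hi => (key i hi).1
  · rw [div_le_iff₀ hc, mul_comm, ← nsmul_eq_mul]
    exact Finset.sum_le_card_nsmul _ _ _ fun i hi => (key i hi).2

theorem quasiInterpolant_error (h : IsClampedKnots a b m n τ) (hab : a < b) (hm : 1 ≤ m)
    (ht : t ∈ Icc a b) {D M : ℝ} (hD : ∀ j ≤ n, τ (j + m + 1) - τ j ≤ D) (F : ℕ → ℝ → ℝ)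
    (hF : ∀ k < m, ∀ x ∈ Icc a b, HasDerivWithinAt (F k) (F (k + 1) x) (Icc a b) x)
    (hM : ∀ x ∈ Icc a b, |F m x| ≤ M) :
    |F 0 t - ∑ j ∈ Finset.range (n + 1), quasiCoeff τ m (F 0) j * coxDeBoor τ b m j t|
      ≤ polarConst m * (M * D ^ m) := by
  let p : ℝ → ℝ := fun y => ∑ k ∈ Finset.range m, F k t / k.factorial * (y - t) ^ k
  -- The quasi-interpolant is exact on the Taylor polynomial at `t`, so at `t` only the remainder,
  -- sampled in supports containing `t`, contributes.
  have hp : ∑ j ∈ Finset.range (n + 1), coxDeBoor τ b m j t * quasiCoeff τ m p j = F 0 t := by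
    have e : ∀ j, quasiCoeff τ m p j = ∑ k ∈ Finset.range m, F k t / k.factorial *
        quasiCoeff τ m (fun y => (y - t) ^ k) j := by
      intro j
      simp only [quasiCoeff, p, Finset.mul_sum]
      rw [Finset.sum_comm]
      exact Finset.sum_congr rfl fun _ _ => Finset.sum_congr rfl fun _ _ => by ring
    simp_rw [e, Finset.mul_sum]
    rw [Finset.sum_comm]
    have : ∀ k ∈ Finset.range m, ∑ j ∈ Finset.range (n + 1), coxDeBoor τ b m j t *
        (F k t / k.factorial * quasiCoeff τ m (fun y => (y - t) ^ k) j)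
          = if k = 0 then F 0 t else 0 := by
      intro k hk
      have h1 := sum_coxDeBoor_mul_quasi_pow h hab ht hm (Finset.mem_range.mp hk).le
      simp_rw [mul_left_comm (coxDeBoor τ b m _ t)]
      rw [← Finset.mul_sum, h1]
      rcases Nat.eq_zero_or_pos k with rfl | hk0
      · simp
      · simp [hk0.ne']
    rw [Finset.sum_congr rfl this, Finset.sum_ite_eq' (Finset.range m) 0 (fun _ => F 0 t),
      if_pos (Finset.mem_range.mpr hm)]
  have hM0 : 0 ≤ M := (abs_nonneg _).trans (hM t ht)
  have hsplit : F 0 t - ∑ j ∈ Finset.range (n + 1), quasiCoeff τ m (F 0) j * coxDeBoor τ b m j t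
      = ∑ j ∈ Finset.range (n + 1), coxDeBoor τ b m j t *
          ∑ S : Finset (Fin m), polarWeight m S * (p (knotMean τ j S) - F 0 (knotMean τ j S)) := by
    rw [← hp, ← Finset.sum_sub_distrib]
    refine Finset.sum_congr rfl fun j _ => ?_
    simp only [quasiCoeff, mul_sub, Finset.sum_sub_distrib]
    ring
  rw [hsplit]
  have hterm : ∀ j ∈ Finset.range (n + 1), |coxDeBoor τ b m j t *
      ∑ S : Finset (Fin m), polarWeight m S * (p (knotMean τ j S) - F 0 (knotMean τ j S))|
        ≤ coxDeBoor τ b m j t * (polarConst m * (M * D ^ m)) := by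
    intro j hj
    have hj := Finset.mem_range.mp hj
    have hB := coxDeBoor_nonneg (b := b) (t := t) h.monoUpTo m j (by omega)
    rw [abs_mul, abs_of_nonneg hB]
    by_cases h0 : coxDeBoor τ b m j t = 0
    · simp [h0]
    refine mul_le_mul_of_nonneg_left ?_ hB
    obtain ⟨q1, q2, -⟩ := coxDeBoor_support h.monoUpTo m j (by omega) h0
    rw [polarConst, Finset.sum_mul]
    refine (Finset.abs_sum_le_sum_abs _ _).trans (Finset.sum_le_sum fun S _ => ?_)
    rw [abs_mul]
    rcases S.eq_empty_or_nonempty with rfl | hS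
    · simp [polarWeight_empty hm]
    refine mul_le_mul_of_nonneg_left ?_ (abs_nonneg _)
    obtain ⟨r1, r2⟩ := knotMean_mem h.monoUpTo (j := j) (by omega) hS
    have ha : a ≤ τ j := by
      rw [← h.left 0 m.zero_le]
      exact h.monoUpTo.le j.zero_le (by omega)
    have hb : τ (j + m + 1) ≤ b := by
      rw [← h.right (n + m + 1) (by omega) le_rfl]
      exact h.monoUpTo.le (by omega) le_rfl
    rw [abs_sub_comm]
    refine (taylor_remainder_le ht ⟨ha.trans r1, r2.trans hb⟩ m F hF hM).trans ?_
    have : |knotMean τ j S - t| ≤ D := by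
      have := hD j (by omega)
      rw [abs_le]
      constructor <;> linarith
    gcongr
  refine (Finset.abs_sum_le_sum_abs _ _).trans ((Finset.sum_le_sum hterm).trans ?_)
  rw [← Finset.sum_mul, sum_coxDeBoor_eq_one h hab ht, one_mul]

end QuasiInterpolant

/-! ### Piecewise linear interpolation. -/

section PiecewiseLinear

theorem abs_le_supNormIcc {a b : ℝ} {u : ℝ → ℝ} (hu : ContinuousOn u (Icc a b)) {x : ℝ}
    (hx : x ∈ Icc a b) : |u x| ≤ supNormIcc a b u := by
  obtain ⟨K, hK⟩ := isCompact_Icc.bddAbove_image hu.abs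
  refine le_ciSup (f := fun x : Icc a b => |u x|) ⟨K, ?_⟩ ⟨x, hx⟩
  rintro _ ⟨y, rfl⟩
  exact hK ⟨y, y.2, rfl⟩

theorem hasDerivWithinAt_iteratedDerivWithin {a b : ℝ} (hab : a < b) {f : ℝ → ℝ} {m k : ℕ}
    (hf : ContDiffOn ℝ m f (Icc a b)) (hk : k < m) {x : ℝ} (hx : x ∈ Icc a b) :
    HasDerivWithinAt (iteratedDerivWithin k f (Icc a b))
      (iteratedDerivWithin (k + 1) f (Icc a b) x) (Icc a b) x := by
  rw [iteratedDerivWithin_succ]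
  exact (hf.differentiableOn_iteratedDerivWithin (by exact_mod_cast hk)
    (uniqueDiffOn_Icc hab) x hx).hasDerivWithinAt

/-- One-sided linear interpolation error, for a second derivative bounded below. -/
theorem sub_linear_interpolant_le {u v t M : ℝ} (huv : u < v) (ht : t ∈ Icc u v)
    {f f' f'' : ℝ → ℝ} (hf : ∀ x ∈ Icc u v, HasDerivWithinAt f (f' x) (Icc u v) x)
    (hf' : ∀ x ∈ Icc u v, HasDerivWithinAt f' (f'' x) (Icc u v) x)
    (hM : ∀ x ∈ Icc u v, -M ≤ f'' x) :
    f t - (f u + (f v - f u) / (v - u) * (t - u)) ≤ M / 2 * ((t - u) * (v - t)) := by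
  -- Adding the parabola makes `f` convex, hence below its chord; the chord of the parabola exceeds
  -- it by `M / 2 * ((t - u) * (v - t))`.
  have hconv : ConvexOn ℝ (Icc u v) (fun x => f x + M / 2 * x ^ 2) := by
    have h1 : ∀ x ∈ Icc u v,
        HasDerivWithinAt (fun x => f x + M / 2 * x ^ 2) (f' x + M * x) (Icc u v) x := by
      intro x hx
      refine (hf x hx).add (HasDerivWithinAt.congr_deriv
        (((hasDerivAt_id x).pow 2).const_mul (M / 2)).hasDerivWithinAt ?_)
      simp only [id]
      ring
    refine convexOn_of_hasDerivWithinAt2_nonneg (convex_Icc u v)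
      (f' := fun x => f' x + M * x) (f'' := fun x => f'' x + M)
      (fun x hx => (h1 x hx).continuousWithinAt)
      (fun x hx => (h1 x (interior_subset hx)).mono interior_subset) (fun x hx => ?_)
      (fun x hx => by linarith [hM x (interior_subset hx)])
    refine ((hf' x (interior_subset hx)).mono interior_subset).add (HasDerivWithinAt.congr_deriv
        ((hasDerivAt_id x).const_mul M).hasDerivWithinAt (mul_one M))
  have hd : 0 < v - u := sub_pos.mpr huv
  have key := hconv.2 (left_mem_Icc.mpr huv.le) (right_mem_Icc.mpr huv.le)
    (div_nonneg (sub_nonneg.mpr ht.2) hd.le) (div_nonneg (sub_nonneg.mpr ht.1) hd.le)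
    (by field_simp; ring)
  have e : (v - t) / (v - u) * u + (t - u) / (v - u) * v = t := by
    field_simp
    ring
  simp only [smul_eq_mul, e] at key
  have e2 : (v - t) / (v - u) * (f u + M / 2 * u ^ 2) + (t - u) / (v - u) * (f v + M / 2 * v ^ 2)
      = f u + (f v - f u) / (v - u) * (t - u) + M / 2 * ((t - u) * (v - t)) + M / 2 * t ^ 2 := by
    field_simp
    ring
  linarith

theorem abs_sub_linear_interpolant_le {u v t M : ℝ} (huv : u < v) (ht : t ∈ Icc u v)
    {f f' f'' : ℝ → ℝ} (hf : ∀ x ∈ Icc u v, HasDerivWithinAt f (f' x) (Icc u v) x)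
    (hf' : ∀ x ∈ Icc u v, HasDerivWithinAt f' (f'' x) (Icc u v) x)
    (hM : ∀ x ∈ Icc u v, |f'' x| ≤ M) :
    |f t - (f u + (f v - f u) / (v - u) * (t - u))| ≤ M * (v - u) ^ 2 / 8 := by
  have h1 := sub_linear_interpolant_le huv ht hf hf' fun x hx => (abs_le.mp (hM x hx)).1
  have h2 := sub_linear_interpolant_le (M := M) huv ht (fun x hx => (hf x hx).neg)
    (fun x hx => (hf' x hx).neg) fun x hx => neg_le_neg (abs_le.mp (hM x hx)).2
  have e : (-f) t - ((-f) u + ((-f) v - (-f) u) / (v - u) * (t - u))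
      = -(f t - (f u + (f v - f u) / (v - u) * (t - u))) := by
    simp only [Pi.neg_apply]
    ring
  rw [e] at h2
  have hM0 : 0 ≤ M := (abs_nonneg _).trans (hM t ht)
  -- Arithmetic-geometric mean inequality, the source of the constant `1/8`.
  have h3 : M / 2 * ((t - u) * (v - t)) ≤ M * (v - u) ^ 2 / 8 := by
    nlinarith [mul_nonneg hM0 (sq_nonneg ((t - u) - (v - t)))]
  exact abs_le.mpr ⟨by linarith, by linarith⟩

theorem abs_sub_piecewiseLinear_le {a b : ℝ} (hab : a < b) {n : ℕ} (hn : 1 ≤ n) {f : ℝ → ℝ}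
    (hf : ContDiffOn ℝ 2 f (Icc a b)) {t : ℝ} (ht : t ∈ Icc a b) :
    |f t - piecewiseLinear a b n f t|
      ≤ (b - a) ^ 2 / 8 * supNormIcc a b (iteratedDerivWithin 2 f (Icc a b))
        * (n : ℝ) ^ (-2 : ℤ) := by
  have hn0 : (0 : ℝ) < n := by exact_mod_cast hn
  set h : ℝ := (b - a) / n with hh
  have hpos : 0 < h := div_pos (sub_pos.mpr hab) hn0
  have hnh : n * h = b - a := by rw [hh]; field_simp
  set i : ℕ := min ⌊(t - a) / h⌋₊ (n - 1) with hi
  have hq : 0 ≤ (t - a) / h := div_nonneg (sub_nonneg.mpr ht.1) hpos.le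
  have hin : (i : ℝ) + 1 ≤ n := by
    have : i ≤ n - 1 := min_le_right _ _
    exact_mod_cast (by omega : i + 1 ≤ n)
  have hut : a + i * h ≤ t := by
    have h1 : (i : ℝ) ≤ (t - a) / h :=
      (Nat.cast_le.mpr (min_le_left _ _)).trans (Nat.floor_le hq)
    rw [le_div_iff₀ hpos] at h1
    linarith
  have htv : t ≤ a + (i + 1) * h := by
    rcases min_choice ⌊(t - a) / h⌋₊ (n - 1) with hc | hc
    · have h1 := (Nat.lt_floor_add_one ((t - a) / h)).le
      rw [← hc, ← hi, div_le_iff₀ hpos] at h1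
      linarith
    · have h1 : (i : ℝ) + 1 = n := by
        rw [hi, hc]
        exact_mod_cast (by omega : n - 1 + 1 = n)
      rw [h1, hnh]
      linarith [ht.2]
  have hsub : Icc (a + i * h) (a + (i + 1) * h) ⊆ Icc a b := by
    refine Icc_subset_Icc (le_add_of_nonneg_right (by positivity)) ?_
    have : (i + 1) * h ≤ n * h := by gcongr
    linarith
  have key := abs_sub_linear_interpolant_le (u := a + i * h) (v := a + (i + 1) * h) (t := t)
    (M := supNormIcc a b (iteratedDerivWithin 2 f (Icc a b))) (by linarith) ⟨hut, htv⟩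
    (f := f) (f' := iteratedDerivWithin 1 f (Icc a b)) (f'' := iteratedDerivWithin 2 f (Icc a b))
    (fun x hx => by
      simpa using (hasDerivWithinAt_iteratedDerivWithin hab hf zero_lt_two (hsub hx)).mono hsub)
    (fun x hx => (hasDerivWithinAt_iteratedDerivWithin hab hf one_lt_two (hsub hx)).mono hsub)
    (fun x hx => abs_le_supNormIcc
      (hf.continuousOn_iteratedDerivWithin le_rfl (uniqueDiffOn_Icc hab)) (hsub hx))
  refine key.trans_eq ?_
  have e : a + (i + 1) * h - (a + i * h) = h := by ring
  rw [e, hh, zpow_neg, div_pow]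
  norm_cast
  ring

end PiecewiseLinear

/-! ### Collocation and the Schoenberg-Whitney conditions. -/

section Collocation

variable {τ : ℕ → ℝ} {a b : ℝ} {m n : ℕ}

/-- The collocation map: from coefficients to the values of the spline at the nodes. -/
noncomputable def collocation (a b : ℝ) (m n : ℕ) (τ : ℕ → ℝ) :
    (Fin (n + 1) → ℝ) →ₗ[ℝ] (Fin (n + 1) → ℝ) :=
  (Matrix.of fun i j : Fin (n + 1) =>
    coxDeBoor τ b m j (a + (i : ℕ) * ((b - a) / n))).mulVecLin

theorem collocation_apply (c : Fin (n + 1) → ℝ) (i : Fin (n + 1)) :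
    collocation a b m n τ c i
      = ∑ j : Fin (n + 1), c j * coxDeBoor τ b m j (a + (i : ℕ) * ((b - a) / n)) := by
  simp only [collocation, Matrix.mulVecLin_apply, Matrix.mulVec, dotProduct, Matrix.of_apply]
  exact Finset.sum_congr rfl fun j _ => mul_comm _ _

theorem exists_continuous_of_values (hab : a < b) (hn : 1 ≤ n) (v : Fin (n + 1) → ℝ) :
    ∃ g : C(Icc a b, ℝ), ∀ i, g (equiNode hab.le n i) = v i := by
  have hn0 : (0 : ℝ) < n := by exact_mod_cast hn
  have hinj : Function.Injective fun i : Fin (n + 1) => a + (i : ℕ) * ((b - a) / (n : ℝ)) := by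
    intro i j hij
    have hne : (b - a) / (n : ℝ) ≠ 0 := (div_pos (sub_pos.mpr hab) hn0).ne'
    simpa [hne, Fin.ext_iff] using hij
  let p := Lagrange.interpolate Finset.univ
    (fun i : Fin (n + 1) => a + (i : ℕ) * ((b - a) / (n : ℝ))) v
  refine ⟨⟨fun x => p.eval (x : ℝ), p.continuous.comp continuous_subtype_val⟩, fun i => ?_⟩
  exact Lagrange.eval_interpolate_at_node v hinj.injOn (Finset.mem_univ i)

theorem collocation_surjective (hab : a < b) (hn : 1 ≤ n)
    (hI : InterpolationWellDefined hab.le m n τ) :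
    Function.Surjective (collocation a b m n τ) := by
  intro v
  obtain ⟨g, hg⟩ := exists_continuous_of_values hab hn v
  obtain ⟨s, ⟨c, hc⟩, hs⟩ := (hI g).exists
  refine ⟨c, funext fun i => ?_⟩
  rw [collocation_apply, ← hg i, ← hs i, hc]
  rfl

theorem collocation_injective (hab : a < b) (hn : 1 ≤ n)
    (hI : InterpolationWellDefined hab.le m n τ) :
    Function.Injective (collocation a b m n τ) :=
  LinearMap.injective_iff_surjective.mpr (collocation_surjective hab hn hI)

/-- Repeated knots could make a B-spline combination discontinuous. Here the continuous interpolant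
of its nodal values exists, and injectivity of collocation forces it to have the same coefficients.
-/
theorem exists_mem_splineSpace (hab : a < b) (hn : 1 ≤ n)
    (hI : InterpolationWellDefined hab.le m n τ) (c : Fin (n + 1) → ℝ) :
    ∃ s : C(Icc a b, ℝ), s ∈ splineSpace a b m n τ ∧
      ∀ x : Icc a b, s x = ∑ j : Fin (n + 1), c j * coxDeBoor τ b m (j : ℕ) (x : ℝ) := by
  obtain ⟨g, hg⟩ := exists_continuous_of_values hab hn (collocation a b m n τ c)
  obtain ⟨s, ⟨c', hc'⟩, hs⟩ := (hI g).exists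
  have : c' = c := by
    refine collocation_injective hab hn hI (funext fun i => ?_)
    rw [← hg i, ← hs i, hc', collocation_apply]
    rfl
  subst this
  exact ⟨s, ⟨c', hc'⟩, hc'⟩

/-- If more basis functions are given than nodes at which one of them can be nonzero,
the collocation map is not injective. -/
theorem collocation_not_injective (J K : Finset (Fin (n + 1))) (hcard : K.card < J.card)
    (hz : ∀ j ∈ J, ∀ i ∉ K, coxDeBoor τ b m j (a + (i : ℕ) * ((b - a) / n)) = 0) :
    ¬ Function.Injective (collocation a b m n τ) := by
  intro hinj
  classical
  -- Extending by zero, collocating and restricting to `K` would embed `ℝ^J` in `ℝ^K`.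
  let E : (J → ℝ) →ₗ[ℝ] (Fin (n + 1) → ℝ) := Function.ExtendByZero.linearMap ℝ Subtype.val
  let R : (Fin (n + 1) → ℝ) →ₗ[ℝ] (K → ℝ) := LinearMap.funLeft ℝ ℝ Subtype.val
  have hE : ∀ c : J → ℝ, ∀ j ∉ J, E c j = 0 := by
    intro c j hj
    refine Function.extend_apply' _ _ _ ?_
    rintro ⟨k, rfl⟩
    exact hj k.2
  have hE' : ∀ (c : J → ℝ) (j : J), E c j = c j := fun c j =>
    Subtype.val_injective.extend_apply _ _ _
  have h : Function.Injective (R ∘ₗ collocation a b m n τ ∘ₗ E) := by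
    rw [← LinearMap.ker_eq_bot, LinearMap.ker_eq_bot']
    intro c hc
    have h1 : collocation a b m n τ (E c) = 0 := by
      funext i
      by_cases hi : i ∈ K
      · exact congrFun hc ⟨i, hi⟩
      · rw [collocation_apply]
        refine Finset.sum_eq_zero fun j _ => ?_
        by_cases hj : j ∈ J
        · rw [hz j hj i hi, mul_zero]
        · rw [hE c j hj, zero_mul]
    have h2 : E c = 0 := hinj (h1.trans (map_zero _).symm)
    funext j
    rw [← hE' c j, h2]
    rfl
  have := LinearMap.finrank_le_finrank_of_injective h
  simp only [Module.finrank_fintype_fun_eq_card, Fintype.card_coe] at this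
  omega

/-- The necessity part of the Schoenberg-Whitney conditions, upper bounds for the knots. -/
theorem knot_le_node (h : IsClampedKnots a b m n τ) (hab : a < b)
    (hinj : Function.Injective (collocation a b m n τ)) {k : ℕ} (hk : k ≤ n + m + 1) (hn : 1 ≤ n) :
    τ k ≤ a + k * ((b - a) / n) := by
  have hn0 : (0 : ℝ) < n := by exact_mod_cast hn
  have hpos : 0 < (b - a) / (n : ℝ) := div_pos (sub_pos.mpr hab) hn0
  rcases Nat.lt_or_ge n k with hnk | hnk
  · rw [h.right k hnk hk]
    have : (n : ℝ) * ((b - a) / n) ≤ k * ((b - a) / n) := by gcongr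
    rw [mul_div_cancel₀ _ hn0.ne'] at this
    linarith
  by_contra! hlt
  have hk1 : 1 ≤ k := by
    by_contra! hk0
    have : k = 0 := by omega
    subst this
    simp [h.left 0 m.zero_le] at hlt
  -- If the `k`-th knot lies beyond the `k`-th node, the B-splines with `j ≥ k` vanish at all nodes
  -- with `i ≤ k`: one node too few remains.
  refine collocation_not_injective (Finset.Ici (⟨k, by omega⟩ : Fin (n + 1)))
    (Finset.Ioi ⟨k, by omega⟩) ?_ ?_ hinj
  · rw [Fin.card_Ici, Fin.card_Ioi]
    simp only
    omega
  · intro j hj i hi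
    have hj : k ≤ j := by simpa [Fin.le_def] using hj
    have hi : (i : ℕ) ≤ k := by simpa [Fin.lt_def] using hi
    by_contra h0
    have h1 := (coxDeBoor_support h.monoUpTo m j (by omega) h0).1
    have h2 := h.monoUpTo.le hj (by omega)
    have h3 : ((i : ℕ) : ℝ) * ((b - a) / n) ≤ k * ((b - a) / n) := by gcongr
    linarith

/-- The necessity part of the Schoenberg-Whitney conditions, lower bounds for the knots. -/
theorem node_le_knot (h : IsClampedKnots a b m n τ) (hab : a < b)
    (hinj : Function.Injective (collocation a b m n τ)) {k : ℕ} (hk : k ≤ n) (hn : 1 ≤ n) :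
    a + k * ((b - a) / n) ≤ τ (k + m + 1) := by
  have hn0 : (0 : ℝ) < n := by exact_mod_cast hn
  have hpos : 0 < (b - a) / (n : ℝ) := div_pos (sub_pos.mpr hab) hn0
  by_contra! hlt
  refine collocation_not_injective (Finset.Iic (⟨k, by omega⟩ : Fin (n + 1)))
    (Finset.Iio ⟨k, by omega⟩) ?_ ?_ hinj
  · rw [Fin.card_Iic, Fin.card_Iio]
    simp
  · intro j hj i hi
    have hj : (j : ℕ) ≤ k := by simpa [Fin.le_def] using hj
    have hi : k ≤ (i : ℕ) := by simpa [Fin.lt_def] using hi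
    by_contra h0
    have h1 := (coxDeBoor_support h.monoUpTo m j (by omega) h0).2.1
    have h2 := h.monoUpTo.le (i := (j : ℕ) + m + 1) (j := k + m + 1) (by omega) (by omega)
    have h3 : (k : ℝ) * ((b - a) / n) ≤ (i : ℕ) * ((b - a) / n) := by gcongr
    linarith

/-- For `j > m`, the support lies between the nodes of index `j - m - 1` and (formally, if beyond
`n`) `j + m + 1`, which are `2m + 2` steps apart. For `j ≤ m` it starts at `a`. -/
theorem support_length_le (h : IsClampedKnots a b m n τ) (hab : a < b)
    (hinj : Function.Injective (collocation a b m n τ)) (hn : 1 ≤ n) {j : ℕ} (hj : j ≤ n) :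
    τ (j + m + 1) - τ j ≤ (2 * m + 2) * ((b - a) / n) := by
  have h1 := knot_le_node h hab hinj (k := j + m + 1) (by omega) hn
  have hpos : 0 < (b - a) / (n : ℝ) := div_pos (sub_pos.mpr hab) (by exact_mod_cast hn)
  push_cast at h1
  rcases Nat.lt_or_ge m j with hmj | hmj
  · obtain ⟨k, rfl⟩ : ∃ k, j = k + m + 1 := ⟨j - m - 1, by omega⟩
    have h2 := node_le_knot h hab hinj (k := k) (by omega) hn
    push_cast at h1
    nlinarith
  · rw [h.left j hmj]
    have : (j : ℝ) ≤ m := by exact_mod_cast hmj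
    nlinarith

end Collocation

/-! ### The interpolation operator and Lebesgue's inequality. -/

section Interpolation

variable {τ : ℕ → ℝ} {a b : ℝ} {m n : ℕ}

theorem splineInterpolation_spec {hab : a ≤ b} (hI : InterpolationWellDefined hab m n τ)
    (g : C(Icc a b, ℝ)) : splineInterpolation hI g ∈ splineSpace a b m n τ ∧
      ∀ i, splineInterpolation hI g (equiNode hab n i) = g (equiNode hab n i) :=
  (hI g).exists.choose_spec

theorem splineInterpolation_sub {hab : a ≤ b} (hI : InterpolationWellDefined hab m n τ)
    (f : C(Icc a b, ℝ)) {s : C(Icc a b, ℝ)} (hs : s ∈ splineSpace a b m n τ) :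
    splineInterpolation hI (f - s) = splineInterpolation hI f - s := by
  obtain ⟨⟨c, hc⟩, hv⟩ := splineInterpolation_spec hI f
  obtain ⟨d, hd⟩ := hs
  refine (hI (f - s)).unique (splineInterpolation_spec hI (f - s))
    ⟨⟨c - d, fun x => ?_⟩, fun i => ?_⟩
  · simp only [ContinuousMap.sub_apply, hc, hd, Pi.sub_apply, sub_mul, Finset.sum_sub_distrib]
  · simp only [ContinuousMap.sub_apply, hv]

theorem interpolationNorm_nonneg {hab : a ≤ b} (hI : InterpolationWellDefined hab m n τ) :
    0 ≤ interpolationNorm hI := by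
  refine Real.sSup_nonneg ?_
  rintro _ ⟨g, -, rfl⟩
  positivity

theorem norm_splineInterpolation_le {hab : a ≤ b} (hI : InterpolationWellDefined hab m n τ)
    (hB : BddAbove (interpolationRatios hI)) (g : C(Icc a b, ℝ)) :
    ‖splineInterpolation hI g‖ ≤ interpolationNorm hI * ‖g‖ := by
  by_cases hg : g = 0
  · have h0 : splineInterpolation hI (0 : C(Icc a b, ℝ)) = 0 :=
      (hI 0).unique (splineInterpolation_spec hI 0) ⟨⟨0, by simp⟩, by simp⟩
    simp [hg, h0]
  · rw [← div_le_iff₀ (norm_pos_iff.mpr hg)]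
    exact le_csSup hB ⟨g, hg, rfl⟩

/-- Lebesgue's inequality. -/
theorem norm_sub_splineInterpolation_le {hab : a ≤ b} (hI : InterpolationWellDefined hab m n τ)
    (hB : BddAbove (interpolationRatios hI)) (f : C(Icc a b, ℝ)) {s : C(Icc a b, ℝ)}
    (hs : s ∈ splineSpace a b m n τ) :
    ‖f - splineInterpolation hI f‖ ≤ (1 + interpolationNorm hI) * ‖f - s‖ := by
  have e : f - splineInterpolation hI f = (f - s) - splineInterpolation hI (f - s) := by
    rw [splineInterpolation_sub hI f hs]
    abel
  rw [e, add_mul, one_mul]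
  exact (norm_sub_le _ _).trans (by gcongr; exact norm_splineInterpolation_le hI hB _)

end Interpolation

/-! ### The main theorem. -/

theorem theorem4p1 (a b : ℝ) (hab : a < b) (m : ℕ) (hm : 1 ≤ m) :
    (∃ C : ℝ, 0 < C ∧
      ∀ (n : ℕ), 1 ≤ n → ∀ (τ : ℕ → ℝ), IsClampedKnots a b m n τ →
      ∀ (hI : InterpolationWellDefined hab.le m n τ), BddAbove (interpolationRatios hI) →
      ∀ (f : ℝ → ℝ) (hf : ContDiffOn ℝ m f (Icc a b)),
        ‖toContIcc f hf.continuousOn - splineInterpolation hI (toContIcc f hf.continuousOn)‖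
          ≤ (1 + interpolationNorm hI) * C * (n : ℝ) ^ (-(m : ℤ))
            * supNormIcc a b (iteratedDerivWithin m f (Icc a b))) ∧
    (∀ (n : ℕ), 1 ≤ n → ∀ (f : ℝ → ℝ), ContDiffOn ℝ 2 f (Icc a b) →
      ∀ t ∈ Icc a b,
        |f t - piecewiseLinear a b n f t|
          ≤ (b - a) ^ 2 / 8 * supNormIcc a b (iteratedDerivWithin 2 f (Icc a b))
            * (n : ℝ) ^ (-2 : ℤ)) := by
  constructor
  -- The quasi-interpolant bound with `D = (2m + 2)(b - a)/n`; the `+ 1` only secures positivity.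
  · refine ⟨polarConst m * ((2 * m + 2) * (b - a)) ^ m + 1, ?_, ?_⟩
    · have := polarConst_nonneg m
      have : 0 < b - a := sub_pos.mpr hab
      positivity
    intro n hn τ hτ hI hB f hf
    have hn0 : (0 : ℝ) < n := by exact_mod_cast hn
    set M := supNormIcc a b (iteratedDerivWithin m f (Icc a b)) with hM
    have hbound : ∀ x ∈ Icc a b, |iteratedDerivWithin m f (Icc a b) x| ≤ M := fun x hx =>
      abs_le_supNormIcc (hf.continuousOn_iteratedDerivWithin le_rfl (uniqueDiffOn_Icc hab)) hx
    have hM0 : 0 ≤ M := (abs_nonneg _).trans (hbound a (left_mem_Icc.mpr hab.le))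
    have hI0 := interpolationNorm_nonneg hI
    obtain ⟨s, hs, hsc⟩ := exists_mem_splineSpace hab hn hI fun j => quasiCoeff τ m f j
    have hdist : ‖toContIcc f hf.continuousOn - s‖
        ≤ polarConst m * (M * ((2 * m + 2) * ((b - a) / n)) ^ m) := by
      have hba : 0 < b - a := sub_pos.mpr hab
      rw [ContinuousMap.norm_le _ (by have := polarConst_nonneg m; positivity)]
      intro x
      have h1 := quasiInterpolant_error hτ hab hm x.2
        (fun j hj => support_length_le hτ hab (collocation_injective hab hn hI) hn hj)
        (fun k => iteratedDerivWithin k f (Icc a b))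
        (fun k hk x hx => hasDerivWithinAt_iteratedDerivWithin hab hf hk hx) hbound
      rw [Finset.sum_range, iteratedDerivWithin_zero] at h1
      rw [ContinuousMap.sub_apply, hsc]
      exact h1
    refine (norm_sub_splineInterpolation_le hI hB _ hs).trans ?_
    rw [mul_assoc, mul_assoc]
    refine mul_le_mul_of_nonneg_left (hdist.trans ?_) (by linarith)
    have e : polarConst m * (M * ((2 * m + 2) * ((b - a) / n)) ^ m)
        = polarConst m * ((2 * m + 2) * (b - a)) ^ m * ((n : ℝ) ^ (-(m : ℤ)) * M) := by
      rw [zpow_neg, zpow_natCast, ← mul_div_assoc, div_pow]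
      ring
    rw [e]
    gcongr
    linarith
  · exact fun n hn f hf t ht => abs_sub_piecewiseLinear_le hab hn hf ht
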